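/- Let $\mathsf h\neq\{0\}$ be a finite-dimensional complex Hilbert space, $\mathcal B(\mathsf h)$ the algebra of all linear operators on it, and let $\mathcal T=(\mathcal T_t)_{t\ge 0}$ be a quantum Markov semigroup on $\mathcal B(\mathsf h)$, i.e. a (weak$^*$-)continuous semigroup ($\mathcal T_0=\mathrm{id}$, $\mathcal T_{s+t}=\mathcal T_s\mathcal T_t$) of completely positive linear maps with $\mathcal T_t(\mathbf 1)=\mathbf 1$. Let $\mathcal L=\lim_{t\to0^+}(\mathcal T_t-\mathrm{id})/t$ be its generator, $\sigma(\mathcal L)$ the spectrum of $\mathcal L$, and $\mathcal T_{*t}$ the predual maps, defined by $\operatorname{tr}(\mathcal T_{*t}(\eta)x)=\operatorname{tr}(\eta\,\mathcal T_t(x))$ for all $\eta,x\in\mathcal B(\mathsf h)$. A density is a positive operator of trace $1$; it is faithful if its range is all of $\mathsf h$, and invariant if $\mathcal T_{*t}(\rho)=\rho$ for all $t\ge0$. A completely positive map $\Phi$ is irreducible if the only orthogonal projections $p$ with $\Phi(p)\ge p$ are $0$ and $\mathbf 1$. The semigroup $\mathcal T$ is - irreducible if the only orthogonal projections $p$ with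 $\mathcal T_t(p)\ge p$ for all $t\ge 0$ are $0$ and $\mathbf 1$; - primitive if it has a unique invariant density and this density is faithful; - ergodic if for every density $\eta$ there is a density $\rho$ with $\lim_{t\to+\infty}\mathcal T_{*t}(\eta)=\rho$ in trace norm; - positivity improving if $x\ge 0$, $x\ne 0$ implies $\mathcal T_t(x)>0$ (positive and invertible) for all $t>0$. Then the following are equivalent: 1. $\mathcal T$ is irreducible; 2. $\mathcal T$ is primitive; 3. $\mathcal T_{t_0}$ is irreducible for all $t_0>0$; 4. $\mathcal T_{t_0}$ is irreducible for some $t_0>0$; 5. $\mathcal T$ is primitive and $\sigma(\mathcal L)\cap \mathrm i\mathbb R=\{0\}$; 6. (a) $\mathcal T$ is ergodic and every limit density is faithful; or, equivalently, (b) there is one faithful density $\rho$ such that $\lim_{t\to+\infty}\mathcal T_{*t}(\eta)=\rho$ in trace norm for every density $\eta$; 7. $\mathcal T$ is positivity improving. -/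

import Mathlib

open scoped NNReal CStarAlgebra InnerProductSpace

/-! Throughout, `H` is a finite-dimensional complex Hilbert space and `H →L[ℂ] H` is the algebra
of all operators on it, with its Loewner order. Every operator on `H` is trace class. -/

noncomputable section

namespace Quantum

variable {H : Type*} [NormedAddCommGroup H] [InnerProductSpace ℂ H] [CompleteSpace H]
  [FiniteDimensional ℂ H]

/-- The trace of an operator. -/
def tr (x : H →L[ℂ] H) : ℂ := LinearMap.trace ℂ H (x : H →ₗ[ℂ] H)

theorem tr_rankOne_mul (u v : H) (x : H →L[ℂ] H) :
    tr (InnerProductSpace.rankOne ℂ v u * x) = ⟪u, x v⟫_ℂ := by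
  have h := LinearMap.trace_mul_comm ℂ
    ((InnerProductSpace.rankOne ℂ v u : H →L[ℂ] H) : H →ₗ[ℂ] H) (x : H →ₗ[ℂ] H)
  have h' : tr (InnerProductSpace.rankOne ℂ v u * x)
      = tr (x * InnerProductSpace.rankOne ℂ v u) := h
  rw [h', ContinuousLinearMap.mul_def, InnerProductSpace.comp_rankOne]
  exact InnerProductSpace.trace_rankOne _ _

/-- The trace norm `tr |x|`, with `|x| = (x* x)^{1/2}`. -/
def traceNorm (x : H →L[ℂ] H) : ℝ := (tr (CFC.abs x)).re

/-- The trace duality `(η, x) ↦ tr (η x)` as a bilinear form. -/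
def traceForm (H : Type*) [NormedAddCommGroup H] [InnerProductSpace ℂ H]
    [FiniteDimensional ℂ H] : LinearMap.BilinForm ℂ (H →L[ℂ] H) :=
  LinearMap.mk₂ ℂ (fun η x => tr (η * x))
    (fun a b x => by simp [tr, add_mul])
    (fun c a x => by simp [tr])
    (fun a x y => by simp [tr, mul_add])
    (fun c a x => by simp [tr])

theorem tr_mul_comm (x y : H →L[ℂ] H) : tr (x * y) = tr (y * x) :=
  LinearMap.trace_mul_comm ℂ (x : H →ₗ[ℂ] H) (y : H →ₗ[ℂ] H)

theorem eq_zero_of_tr (x : H →L[ℂ] H) (h : ∀ η : H →L[ℂ] H, tr (η * x) = 0) : x = 0 := by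
  ext v
  refine ext_inner_left ℂ fun u => ?_
  rw [← tr_rankOne_mul, h]
  simp

theorem traceForm_nondegenerate : (traceForm H).Nondegenerate := by
  refine ⟨fun x hx => eq_zero_of_tr x fun η => ?_, fun x hx => eq_zero_of_tr x fun η => hx η⟩
  rw [tr_mul_comm]
  exact hx η

/-- The predual `Φ_*` of a linear map `Φ` on operators: the unique linear map such that
`tr (Φ_* η · x) = tr (η · Φ x)` for all `η` and `x`. -/
def predual (Φ : (H →L[ℂ] H) →ₗ[ℂ] (H →L[ℂ] H)) : (H →L[ℂ] H) →ₗ[ℂ] (H →L[ℂ] H) :=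
  (traceForm H).leftAdjointOfNondegenerate traceForm_nondegenerate Φ

theorem tr_predual_mul (Φ : (H →L[ℂ] H) →ₗ[ℂ] (H →L[ℂ] H)) (η x : H →L[ℂ] H) :
    tr (predual Φ η * x) = tr (η * Φ x) :=
  LinearMap.BilinForm.isAdjointPairLeftAdjointOfNondegenerate (traceForm H)
    traceForm_nondegenerate Φ η x

/-- A density: a positive operator of unit trace. -/
def IsDensity (ρ : H →L[ℂ] H) : Prop := 0 ≤ ρ ∧ tr ρ = 1

/-- The support of an operator: the closure of its range. -/
def support (ρ : H →L[ℂ] H) : Submodule ℂ H := (LinearMap.range (ρ : H →ₗ[ℂ] H)).topologicalClosure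

/-- A density is faithful if its support is the whole space. -/
def IsFaithful (ρ : H →L[ℂ] H) : Prop := support ρ = ⊤

/-- A completely positive map is irreducible if it has no non-trivial subharmonic projection. -/
def IsIrreducibleMap (Φ : (H →L[ℂ] H) →CP (H →L[ℂ] H)) : Prop :=
  ∀ p : H →L[ℂ] H, IsStarProjection p → p ≤ Φ p → p = 0 ∨ p = 1

/-- A norm continuous semigroup of operators on a Banach space is differentiable at `0`. -/
theorem exists_hasDerivWithinAt_of_semigroup {E : Type*} [NormedAddCommGroup E]
    [NormedSpace ℂ E] [CompleteSpace E] (S : ℝ → (E →L[ℂ] E)) (hSc : Continuous S)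
    (hS0 : S 0 = 1) (hSadd : ∀ s t : ℝ, 0 ≤ s → 0 ≤ t → S (s + t) = S s * S t) :
    ∃ L : E →L[ℂ] E, ∀ x, HasDerivWithinAt (fun t => S t x) (L x) (Set.Ici 0) 0 := by
  let F : ℝ → (E →L[ℂ] E) := fun t => ∫ s in (0 : ℝ)..t, S s
  have hF : ∀ t, HasDerivAt F (S t) t := fun t => hSc.integral_hasStrictDerivAt 0 t |>.hasDerivAt
  have hF0 : F 0 = 0 := by simp [F]
  -- some `F a` is invertible
  obtain ⟨a, ha, u, hu⟩ : ∃ a : ℝ, 0 < a ∧ IsUnit (F a) := by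
    have h1 := (hF 0).tendsto_slope_zero_right
    rw [hS0] at h1
    have h2 := h1.eventually (Units.isOpen.mem_nhds (isUnit_one : IsUnit (1 : E →L[ℂ] E)))
    obtain ⟨a, ha, ha0⟩ := (h2.and self_mem_nhdsWithin).exists
    have ha0' : (0 : ℝ) < a := ha0
    refine ⟨a, ha0', ?_⟩
    have ha' : IsUnit (a⁻¹ • F a) := by simpa [hF0] using ha
    have h3 := ha'.smul (Units.mk0 a ha0'.ne')
    rwa [Units.smul_mk0, smul_inv_smul₀ ha0'.ne'] at h3
  have hkey : ∀ t : ℝ, 0 ≤ t → S t = (F (t + a) - F t) * ↑u⁻¹ := by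
    intro t ht
    have h1 : S t * F a = F (t + a) - F t := by
      have e1 : F (t + a) - F t = ∫ s in t..(t + a), S s :=
        intervalIntegral.integral_interval_sub_left
          (hSc.intervalIntegrable _ _) (hSc.intervalIntegrable _ _)
      have e2 : ∫ s in t..(t + a), S s = ∫ s in (0 : ℝ)..a, S (t + s) := by
        rw [intervalIntegral.integral_comp_add_left (fun s => S s) t, add_zero]
      have e3 : ∫ s in (0 : ℝ)..a, S (t + s) = ∫ s in (0 : ℝ)..a, S t * S s := by
        refine intervalIntegral.integral_congr fun s hs => ?_
        rw [Set.uIcc_of_le ha.le] at hs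
        exact hSadd t s ht hs.1
      rw [e1, e2, e3]
      exact (((ContinuousLinearMap.mul ℂ (E →L[ℂ] E))
        (S t)).intervalIntegral_comp_comm (hSc.intervalIntegrable 0 a)).symm
    rw [← h1, ← hu, mul_assoc, Units.mul_inv, mul_one]
  have hd : HasDerivWithinAt S ((S (0 + a) - S 0) * ↑u⁻¹) (Set.Ici 0) 0 := by
    have h1 : HasDerivAt (fun t => (F (t + a) - F t) * ((u⁻¹ : (E →L[ℂ] E)ˣ) : E →L[ℂ] E))
        ((S (0 + a) - S 0) * ↑u⁻¹) 0 :=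
      (((hF (0 + a)).comp_add_const 0 a).sub (hF 0)).mul_const _
    exact h1.hasDerivWithinAt.congr (fun t ht => hkey t ht) (hkey 0 le_rfl)
  refine ⟨(S (0 + a) - S 0) * ↑u⁻¹, fun x => ?_⟩
  exact ((ContinuousLinearMap.apply ℂ E x).restrictScalars
    ℝ).hasFDerivAt.comp_hasDerivWithinAt 0 hd

end Quantum

open Quantum

/-- A quantum Markov semigroup on the operators of a finite-dimensional Hilbert space: a weak*
continuous one-parameter semigroup of completely positive, identity preserving maps.
Normality of the maps holds for every linear map here (see `Quantum.tr_predual_mul`). -/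
structure QMS (H : Type*) [NormedAddCommGroup H] [InnerProductSpace ℂ H] [CompleteSpace H]
    [FiniteDimensional ℂ H] where
  /-- The map at time `t`. -/
  map : ℝ≥0 → ((H →L[ℂ] H) →CP (H →L[ℂ] H))
  map_zero : ∀ x, map 0 x = x
  map_add : ∀ s t x, map (s + t) x = map s (map t x)
  map_one : ∀ t, map t 1 = 1
  weakStar_continuous : ∀ η x : H →L[ℂ] H, Continuous fun t => tr (η * map t x)

namespace QMS

variable {H : Type*} [NormedAddCommGroup H] [InnerProductSpace ℂ H] [CompleteSpace H]
  [FiniteDimensional ℂ H] (T : QMS H)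

/-- The predual semigroup. -/
def predual (t : ℝ≥0) : (H →L[ℂ] H) →ₗ[ℂ] (H →L[ℂ] H) :=
  Quantum.predual (T.map t).toLinearMap

theorem continuous_map_apply (x : H →L[ℂ] H) : Continuous fun t => T.map t x := by
  rw [continuous_clm_apply]
  intro v
  have h : (fun t => T.map t x v) = fun t => ∑ i, ⟪stdOrthonormalBasis ℂ H i, T.map t x v⟫_ℂ •
      stdOrthonormalBasis ℂ H i := by
    funext t
    exact ((stdOrthonormalBasis ℂ H).sum_repr' _).symm
  rw [h]
  refine continuous_finsetSum _ fun i _ => Continuous.smul ?_ continuous_const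
  simp_rw [← tr_rankOne_mul]
  exact T.weakStar_continuous _ x

/-- A weak* continuous semigroup on a finite-dimensional space is differentiable at `0`. -/
theorem exists_generator : ∃ L : Module.End ℂ (H →L[ℂ] H), ∀ x : H →L[ℂ] H,
    HasDerivWithinAt (fun t : ℝ => T.map t.toNNReal x) (L x) (Set.Ici 0) 0 := by
  obtain ⟨L, hL⟩ := exists_hasDerivWithinAt_of_semigroup (fun t : ℝ =>
    LinearMap.toContinuousLinearMap (T.map t.toNNReal).toLinearMap)
    (by
      rw [continuous_clm_apply]
      intro x
      exact (T.continuous_map_apply x).comp continuous_real_toNNReal)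
    (by
      ext1 x
      change T.map (Real.toNNReal 0) x = x
      rw [Real.toNNReal_zero, T.map_zero])
    (by
      intro s t hs ht
      ext1 x
      change T.map (Real.toNNReal (s + t)) x = T.map s.toNNReal (T.map t.toNNReal x)
      rw [Real.toNNReal_add hs ht, T.map_add])
  exact ⟨(L : (H →L[ℂ] H) →ₗ[ℂ] (H →L[ℂ] H)), hL⟩

/-- The generator `𝓛` of the semigroup, `𝓛 x = lim_{t → 0+} (𝓣_t x - x) / t`; see
`QMS.hasDerivWithinAt_generator`. -/
def generator : Module.End ℂ (H →L[ℂ] H) := T.exists_generator.choose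

theorem hasDerivWithinAt_generator (x : H →L[ℂ] H) :
    HasDerivWithinAt (fun t : ℝ => T.map t.toNNReal x) (T.generator x) (Set.Ici 0) 0 :=
  T.exists_generator.choose_spec x

/-- The semigroup is irreducible if its maps have no non-trivial common subharmonic projection. -/
def IsIrreducible : Prop :=
  ∀ p : H →L[ℂ] H, IsStarProjection p → (∀ t, p ≤ T.map t p) → p = 0 ∨ p = 1

/-- An invariant density. -/
def IsInvariantDensity (ρ : H →L[ℂ] H) : Prop := IsDensity ρ ∧ ∀ t, T.predual t ρ = ρ

/-- The semigroup is primitive if it has a unique invariant density and this is faithful. -/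
def IsPrimitive : Prop :=
  ∃ ρ, T.IsInvariantDensity ρ ∧ IsFaithful ρ ∧ ∀ ρ', T.IsInvariantDensity ρ' → ρ' = ρ

/-- The evolution of `η` under the predual semigroup converges to `ρ` in trace norm. -/
def RelaxesTo (η ρ : H →L[ℂ] H) : Prop :=
  Filter.Tendsto (fun t => traceNorm (T.predual t η - ρ)) Filter.atTop (nhds 0)

/-- The semigroup is ergodic (relaxing) if the evolution of every density converges, in trace
norm, to a density. -/
def IsErgodic : Prop := ∀ η, IsDensity η → ∃ ρ, IsDensity ρ ∧ T.RelaxesTo η ρ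

/-- The semigroup is positivity improving: `x ≥ 0`, `x ≠ 0` and `t > 0` imply `𝓣_t x > 0`,
that is, `𝓣_t x` is positive and invertible. -/
def IsPositivityImproving : Prop :=
  ∀ x : H →L[ℂ] H, 0 ≤ x → x ≠ 0 → ∀ t : ℝ≥0, 0 < t → IsStrictlyPositive (T.map t x)

end QMS

end

open scoped ComplexOrder

set_option linter.unusedSectionVars false

noncomputable section

namespace Quantum

variable {H : Type*} [NormedAddCommGroup H] [InnerProductSpace ℂ H] [CompleteSpace H]
  [FiniteDimensional ℂ H]

/-! Primitivity is the hub. The support projection of an invariant density is subharmonic, so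
irreducibility makes all invariant densities faithful. Two of them would span a line whose last
density is invariant but not faithful; hence there is only one (`isPrimitive_of_forall_isFaithful`).
The same lemma leads back from convergence, since an invariant density is its own limit.

From primitivity to convergence: the Kadison–Schwarz inequality, tested against the faithful `ρ`,
puts the eigenvalues of `T.map t` in the closed unit disc. If `x` is an eigenvector of the generator
for an imaginary `μ`, then `star x * x` is fixed, hence scalar, so `x` is invertible; equality in
Schwarz makes each `x ^ n` an eigenvector for `n * μ`, and finite dimension forces `μ = 0`. So
`T.map 1` has spectral radius below one on the kernel of `tr (ρ * ·)`, which gives `tendsto_map`.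

From primitivity to positivity improvement: a singular `T.map t x` makes the real analytic function
`s ↦ det (T.map s x)` vanish identically, although the limit `tr (ρ * x) • 1` is invertible.
Positivity improvement rules out subharmonic projections of each single map, which closes the
circle. -/

@[simp] theorem tr_add (a b : H →L[ℂ] H) : tr (a + b) = tr a + tr b := by simp [tr]

@[simp] theorem tr_sub (a b : H →L[ℂ] H) : tr (a - b) = tr a - tr b := by simp [tr]

@[simp] theorem tr_smul (c : ℂ) (a : H →L[ℂ] H) : tr (c • a) = c * tr a := by simp [tr]

@[simp] theorem tr_zero : tr (0 : H →L[ℂ] H) = 0 := by simp [tr]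

@[simp] theorem tr_real_smul (c : ℝ) (a : H →L[ℂ] H) : tr (c • a) = c * tr a := by
  rw [← tr_smul]; rfl

theorem tr_rankOne (v : H) : tr (InnerProductSpace.rankOne ℂ v v) = ⟪v, v⟫_ℂ := by
  simpa using tr_rankOne_mul v v (1 : H →L[ℂ] H)

theorem continuous_tr : Continuous (tr : (H →L[ℂ] H) → ℂ) :=
  (LinearMap.trace ℂ H ∘ₗ ContinuousLinearMap.coeLM ℂ).continuous_of_finiteDimensional

/-! ### Positivity, trace and densities. -/

theorem nonneg_of_inner {a : H →L[ℂ] H} (h : ∀ v, 0 ≤ ⟪v, a v⟫_ℂ) : 0 ≤ a := by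
  rw [ContinuousLinearMap.nonneg_iff_isPositive, ContinuousLinearMap.isPositive_iff_complex]
  intro v
  have h1 : 0 ≤ ⟪a v, v⟫_ℂ := by
    rw [← inner_conj_symm]
    exact star_nonneg_iff.2 (h v)
  rw [Complex.nonneg_iff] at h1
  exact ⟨Complex.ext rfl (by simpa using h1.2), h1.1⟩

theorem inner_nonneg_of_nonneg {a : H →L[ℂ] H} (ha : 0 ≤ a) (v : H) : 0 ≤ ⟪v, a v⟫_ℂ :=
  ((ContinuousLinearMap.nonneg_iff_isPositive a).1 ha).inner_nonneg_right v

theorem rankOne_self_nonneg (v : H) :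
    (0 : H →L[ℂ] H) ≤ InnerProductSpace.rankOne ℂ v v :=
  (ContinuousLinearMap.nonneg_iff_isPositive _).2 (InnerProductSpace.isPositive_rankOne_self v)

theorem isDensity_rankOne_self {v : H} (hv : ‖v‖ = 1) :
    IsDensity (InnerProductSpace.rankOne ℂ v v) :=
  ⟨rankOne_self_nonneg v, by rw [tr_rankOne, inner_self_eq_norm_sq_to_K, hv]; simp⟩

theorem tr_nonneg {a : H →L[ℂ] H} (ha : 0 ≤ a) : 0 ≤ tr a :=
  ((ContinuousLinearMap.isPositive_toLinearMap_iff a).2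
    ((ContinuousLinearMap.nonneg_iff_isPositive a).1 ha)).trace_nonneg

theorem tr_star_mul_self_mul (c d : H →L[ℂ] H) :
    tr (star d * d * (star c * c)) = tr (star (d * star c) * (d * star c)) := by
  rw [← mul_assoc, tr_mul_comm, star_mul, star_star]
  simp only [mul_assoc]

theorem tr_mul_nonneg {a b : H →L[ℂ] H} (ha : 0 ≤ a) (hb : 0 ≤ b) : 0 ≤ tr (a * b) := by
  obtain ⟨d, rfl⟩ := CStarAlgebra.nonneg_iff_eq_star_mul_self.1 ha
  obtain ⟨c, rfl⟩ := CStarAlgebra.nonneg_iff_eq_star_mul_self.1 hb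
  rw [tr_star_mul_self_mul]
  exact tr_nonneg (star_mul_self_nonneg _)

/-- For a unit vector `v` the operator `1 - |v⟩⟨v|` is positive; pairing it with `a` bounds `⟪v, a
v⟫` by the trace. This makes the set of densities bounded and compares the trace norm with the
operator norm. -/
theorem norm_le_tr {a : H →L[ℂ] H} (ha : 0 ≤ a) : ‖a‖ ≤ (tr a).re := by
  have h0 := Complex.nonneg_iff.1 (tr_nonneg ha)
  rw [CStarAlgebra.norm_le_iff_le_algebraMap a h0.1 ha, ← sub_nonneg]
  refine nonneg_of_inner fun v => ?_
  have key : ∀ v : H, ‖v‖ = 1 → 0 ≤ tr a - ⟪v, a v⟫_ℂ := fun v hv => by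
    have hp : (0 : H →L[ℂ] H) ≤ 1 - InnerProductSpace.rankOne ℂ v v := by
      have h1 : ‖(InnerProductSpace.rankOne ℂ v v : H →L[ℂ] H)‖ ≤ 1 := by simp [hv]
      exact sub_nonneg.2 ((CStarAlgebra.norm_le_one_iff_of_nonneg _ (rankOne_self_nonneg v)).1 h1)
    have h2 := tr_mul_nonneg hp ha
    rwa [sub_mul, tr_sub, one_mul, tr_rankOne_mul] at h2
  by_cases hv : v = 0
  · simp [hv]
  have hv' : ‖v‖ ≠ 0 := norm_ne_zero_iff.2 hv
  have h3 := key ((‖v‖⁻¹ : ℂ) • v) (by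
    rw [norm_smul, norm_inv, Complex.norm_real, norm_norm, inv_mul_cancel₀ hv'])
  have h4 : (algebraMap ℝ (H →L[ℂ] H) (tr a).re - a) v = tr a • v - a v := by
    have : ((tr a).re : ℂ) = tr a := Complex.ext rfl (by simpa using h0.2)
    conv_rhs => rw [← this]
    rfl
  have h5 : ⟪v, (algebraMap ℝ (H →L[ℂ] H) (tr a).re - a) v⟫_ℂ
      = (‖v‖ ^ 2 : ℝ) * (tr a - ⟪(‖v‖⁻¹ : ℂ) • v, a ((‖v‖⁻¹ : ℂ) • v)⟫_ℂ) := by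
    rw [h4, inner_sub_right, inner_smul_right, inner_self_eq_norm_sq_to_K, map_smul,
      inner_smul_left, inner_smul_right]
    have : (‖v‖ : ℂ) ≠ 0 := by exact_mod_cast hv'
    simp
    field_simp
  rw [h5]
  exact mul_nonneg (Complex.zero_le_real.2 (sq_nonneg _)) h3

theorem eq_zero_of_tr_eq_zero {a : H →L[ℂ] H} (ha : 0 ≤ a) (h : tr a = 0) : a = 0 := by
  have := norm_le_tr ha
  rw [h] at this
  exact norm_le_zero_iff.1 this

/-- With `a = star d * d` and `b = star c * c`, the trace of `a * b` is the squared Hilbert–Schmidt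
norm of `d * star c`, a factor in the middle of `a * b`. -/
theorem mul_eq_zero_of_tr_mul_eq_zero {a b : H →L[ℂ] H} (ha : 0 ≤ a) (hb : 0 ≤ b)
    (h : tr (a * b) = 0) : a * b = 0 := by
  obtain ⟨d, rfl⟩ := CStarAlgebra.nonneg_iff_eq_star_mul_self.1 ha
  obtain ⟨c, rfl⟩ := CStarAlgebra.nonneg_iff_eq_star_mul_self.1 hb
  rw [tr_star_mul_self_mul] at h
  have hz := CStarRing.star_mul_self_eq_zero_iff _ |>.1
    (eq_zero_of_tr_eq_zero (star_mul_self_nonneg _) h)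
  rw [mul_assoc, ← mul_assoc d, hz]
  simp

theorem isUnit_of_isFaithful {ρ : H →L[ℂ] H} (h : IsFaithful ρ) : IsUnit ρ := by
  have h1 : LinearMap.range (ρ : H →ₗ[ℂ] H) = ⊤ := by
    rw [← h, support]
    exact (Submodule.closed_of_finiteDimensional _).submodule_topologicalClosure_eq.symm
  rw [ContinuousLinearMap.isUnit_iff_bijective]
  have h2 : Function.Surjective (ρ : H →ₗ[ℂ] H) := LinearMap.range_eq_top.1 h1
  exact ⟨LinearMap.injective_iff_surjective.2 h2, h2⟩

theorem eq_zero_of_isFaithful {ρ b : H →L[ℂ] H} (hρ : 0 ≤ ρ) (hf : IsFaithful ρ) (hb : 0 ≤ b)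
    (h : tr (ρ * b) = 0) : b = 0 :=
  (isUnit_of_isFaithful hf).mul_right_eq_zero.1 (mul_eq_zero_of_tr_mul_eq_zero hρ hb h)

theorem tendsto_traceNorm_zero_iff {ι : Type*} {l : Filter ι} {f : ι → H →L[ℂ] H} :
    Filter.Tendsto (fun i => traceNorm (f i)) l (nhds 0) ↔ Filter.Tendsto f l (nhds 0) := by
  constructor
  · intro h
    refine squeeze_zero_norm (fun i => ?_) h
    rw [← CFC.norm_abs (a := f i)]
    exact norm_le_tr (CFC.abs_nonneg _)
  · intro h
    have h1 : Filter.Tendsto (fun i => CFC.abs (f i)) l (nhds 0) := by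
      rw [tendsto_zero_iff_norm_tendsto_zero] at h ⊢
      simpa using h
    have h2 := (Complex.continuous_re.comp (continuous_tr (H := H))).tendsto 0
    simpa [traceNorm, Function.comp_def] using h2.comp h1

theorem exists_pos_algebraMap_le [Nontrivial H] {a : H →L[ℂ] H} (ha : IsStrictlyPositive a) :
    ∃ ε > 0, algebraMap ℝ (H →L[ℂ] H) ε ≤ a :=
  (CFC.exists_pos_algebraMap_le_iff (IsSelfAdjoint.of_nonneg ha.nonneg)).2 fun _ hx =>
    (spectrum_nonneg_of_nonneg ha.nonneg hx).lt_of_ne fun h =>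
      spectrum.zero_notMem ℝ ha.isUnit (h ▸ hx)

/-! ### Preduals -/

theorem predual_unique {Φ : (H →L[ℂ] H) →ₗ[ℂ] (H →L[ℂ] H)} {η ζ : H →L[ℂ] H}
    (h : ∀ x, tr (ζ * x) = tr (η * Φ x)) : predual Φ η = ζ := by
  rw [← sub_eq_zero]
  refine eq_zero_of_tr _ fun x => ?_
  rw [tr_mul_comm, sub_mul, tr_sub, tr_predual_mul, h, sub_self]

theorem predual_nonneg (Φ : (H →L[ℂ] H) →CP (H →L[ℂ] H)) {η : H →L[ℂ] H} (hη : 0 ≤ η) :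
    0 ≤ predual Φ.toLinearMap η := by
  refine nonneg_of_inner fun v => ?_
  rw [← tr_rankOne_mul, tr_mul_comm, tr_predual_mul]
  exact tr_mul_nonneg hη (map_nonneg Φ (rankOne_self_nonneg v))

theorem isDensity_predual {Φ : (H →L[ℂ] H) →CP (H →L[ℂ] H)} (hΦ : Φ 1 = 1) {η : H →L[ℂ] H}
    (hη : IsDensity η) : IsDensity (predual Φ.toLinearMap η) := by
  refine ⟨predual_nonneg Φ hη.1, ?_⟩
  have h := tr_predual_mul Φ.toLinearMap η 1
  have h' : Φ.toLinearMap 1 = 1 := hΦ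
  rwa [h', mul_one, mul_one, hη.2] at h

/-! ### The set of densities -/

theorem isCompact_setOf_isDensity : IsCompact {η : H →L[ℂ] H | IsDensity η} := by
  have : ProperSpace (H →L[ℂ] H) := FiniteDimensional.proper ℂ _
  refine Metric.isCompact_of_isClosed_isBounded ?_ ?_
  · exact isClosed_Ici.inter (isClosed_eq continuous_tr continuous_const)
  · refine (Metric.isBounded_closedBall (x := (0 : H →L[ℂ] H)) (r := 1)).subset fun η hη => ?_
    have := norm_le_tr hη.1
    rw [hη.2] at this
    simpa using this

theorem convex_setOf_isDensity : Convex ℝ {η : H →L[ℂ] H | IsDensity η} := by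
  intro a ha b hb s t hs ht hst
  refine ⟨add_nonneg (smul_nonneg hs ha.1) (smul_nonneg ht hb.1), ?_⟩
  rw [tr_add, tr_real_smul, tr_real_smul, ha.2, hb.2, mul_one, mul_one]
  exact_mod_cast hst

theorem exists_isDensity [Nontrivial H] : ∃ η : H →L[ℂ] H, IsDensity η := by
  obtain ⟨v, hv⟩ := exists_norm_eq H zero_le_one
  exact ⟨_, isDensity_rankOne_self hv⟩

end Quantum

/-! ### Invariant densities and fixed points. -/

/-- A continuous linear map preserving a compact convex set has a fixed point in it. -/
theorem ContinuousLinearMap.exists_fixedPoint_of_convex {E : Type*} [NormedAddCommGroup E]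
    [NormedSpace ℝ E] (f : E →L[ℝ] E) {K : Set E} (hK : IsCompact K) (hc : Convex ℝ K)
    (hne : K.Nonempty) (hf : Set.MapsTo f K K) : ∃ x ∈ K, f x = x := by
  obtain ⟨x, hx⟩ := hne
  -- Averages have `n + 1` terms because the empty average is `0`, which need not lie in `K`.
  have hmem : ∀ n : ℕ, birkhoffAverage ℝ f id (n + 1) x ∈ K := fun n => by
    rw [birkhoffAverage, birkhoffSum, Finset.smul_sum]
    refine hc.sum_mem (fun _ _ => by positivity) ?_ fun k _ => hf.iterate k hx
    rw [Finset.sum_const, Finset.card_range, nsmul_eq_mul, mul_inv_cancel₀ (by positivity)]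
  obtain ⟨y, hy, φ, hφ, hlim⟩ := hK.tendsto_subseq hmem
  have hbdd : Bornology.IsBounded (Set.range fun n => id (f^[n] x)) :=
    hK.isBounded.subset (Set.range_subset_iff.2 fun n => hf.iterate n hx)
  -- The averages from `f x` and from `x` differ only by two end terms over the length, so every
  -- limit point is fixed.
  have h0 := (tendsto_birkhoffAverage_apply_sub_birkhoffAverage ℝ hbdd).comp
    ((Filter.tendsto_add_atTop_nat 1).comp hφ.tendsto_atTop)
  have h1 : ∀ n, birkhoffAverage ℝ f id n (f x) = f (birkhoffAverage ℝ f id n x) := fun n => by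
    simp only [birkhoffAverage, birkhoffSum, map_smul, map_sum, id,
      ← Function.iterate_succ_apply, Function.iterate_succ_apply']
  have h2 := ((f.continuous.tendsto y).comp hlim).sub hlim
  refine ⟨y, hy, sub_eq_zero.1 (tendsto_nhds_unique h2 (h0.congr fun n => ?_))⟩
  simp [h1]

namespace QMS

open Quantum

variable {H : Type*} [NormedAddCommGroup H] [InnerProductSpace ℂ H] [CompleteSpace H]
  [FiniteDimensional ℂ H] (T : QMS H)

theorem tr_predual (t : ℝ≥0) (η x : H →L[ℂ] H) : tr (T.predual t η * x) = tr (η * T.map t x) :=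
  tr_predual_mul _ η x

theorem predual_add (s t : ℝ≥0) (η : H →L[ℂ] H) :
    T.predual (s + t) η = T.predual t (T.predual s η) :=
  predual_unique fun x => by
    rw [T.tr_predual, T.tr_predual, ← T.map_add]
    rfl

theorem predual_zero (η : H →L[ℂ] H) : T.predual 0 η = η :=
  predual_unique fun x => by
    have : (T.map 0).toLinearMap x = x := T.map_zero x
    rw [this]

theorem isDensity_predual {η : H →L[ℂ] H} (hη : IsDensity η) (t : ℝ≥0) :
    IsDensity (T.predual t η) :=
  Quantum.isDensity_predual (T.map_one t) hη

/-- Pairing with rank-one operators recovers all matrix entries, and finitely many entries control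
the norm. -/
theorem tendsto_of_tendsto_tr {ι : Type*} {l : Filter ι} {f : ι → H →L[ℂ] H} {a : H →L[ℂ] H}
    (h : ∀ x, Filter.Tendsto (fun i => tr (f i * x)) l (nhds (tr (a * x)))) :
    Filter.Tendsto f l (nhds a) := by
  have hw : ∀ v : H, Filter.Tendsto (fun i => f i v) l (nhds (a v)) := fun v => by
    have hs : ∀ b : H →L[ℂ] H, b v = ∑ i, ⟪stdOrthonormalBasis ℂ H i, b v⟫_ℂ •
      stdOrthonormalBasis ℂ H i := fun b => ((stdOrthonormalBasis ℂ H).sum_repr' _).symm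
    rw [hs a]
    refine Filter.Tendsto.congr (fun i => (hs (f i)).symm) ?_
    refine tendsto_finsetSum _ fun i _ => Filter.Tendsto.smul ?_ tendsto_const_nhds
    simp_rw [← tr_rankOne_mul, tr_mul_comm (InnerProductSpace.rankOne ℂ _ _)]
    exact h _
  let b := stdOrthonormalBasis ℂ H
  -- an operator is a continuous function of its values on a basis
  let g : (H →L[ℂ] H) →ₗ[ℂ] (Fin (Module.finrank ℂ H) → H) :=
    { toFun := fun c i => c (b i)
      map_add' := fun _ _ => rfl
      map_smul' := fun _ _ => rfl }
  have hg : Function.Injective g := fun c d hcd => by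
    refine ContinuousLinearMap.coe_injective (b.toBasis.ext fun i => ?_)
    simpa [g] using congrFun hcd i
  have hge := LinearMap.isClosedEmbedding_of_injective (LinearMap.ker_eq_bot.2 hg)
  rw [hge.isEmbedding.tendsto_nhds_iff, tendsto_pi_nhds]
  exact fun i => hw (b i)

theorem continuous_predual_apply (η : H →L[ℂ] H) : Continuous fun t => T.predual t η := by
  rw [continuous_iff_continuousAt]
  intro t
  refine tendsto_of_tendsto_tr fun x => ?_
  simp_rw [T.tr_predual]
  exact (T.weakStar_continuous η x).tendsto t

theorem predual_nat_mul {t : ℝ≥0} {η : H →L[ℂ] H} (h : T.predual t η = η) (n : ℕ) :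
    T.predual (n * t) η = η := by
  induction n with
  | zero => simp [T.predual_zero]
  | succ n ih => rw [Nat.cast_succ, add_mul, one_mul, T.predual_add, ih, h]

/-- A closed convex set of densities preserved by the predual semigroup contains an invariant
density. -/
theorem exists_invariant_mem {K : Set (H →L[ℂ] H)} (hKd : K ⊆ {η | IsDensity η})
    (hKc : IsClosed K) (hKx : Convex ℝ K) (hne : K.Nonempty)
    (hK : ∀ t, Set.MapsTo (T.predual t) K K) : ∃ ρ ∈ K, T.IsInvariantDensity ρ := by
  have hcpt : IsCompact K := isCompact_setOf_isDensity.of_isClosed_subset hKc hKd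
  -- A fixed point at time `2⁻ⁿ` is fixed at all multiples of it. A limit point as `n` grows is
  -- therefore fixed at every dyadic time, and by continuity at every time.
  have hfix : ∀ n : ℕ, ∃ ρ ∈ K, T.predual ((2 ^ n : ℝ≥0)⁻¹) ρ = ρ := fun n =>
    ((LinearMap.toContinuousLinearMap (T.predual ((2 ^ n : ℝ≥0)⁻¹))).restrictScalars
      ℝ).exists_fixedPoint_of_convex hcpt hKx hne (hK _)
  choose f hfK hf using hfix
  obtain ⟨ρ, hρ, φ, hφ, hlim⟩ := hcpt.tendsto_subseq hfK
  refine ⟨ρ, hρ, hKd hρ, fun t => ?_⟩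
  have hdy : ∀ k n : ℕ, T.predual (k * (2 ^ n : ℝ≥0)⁻¹) ρ = ρ := fun k n => by
    have hc : Continuous (T.predual (k * (2 ^ n : ℝ≥0)⁻¹)) :=
      LinearMap.continuous_of_finiteDimensional _
    refine tendsto_nhds_unique ((hc.tendsto ρ).comp hlim) (hlim.congr' ?_)
    filter_upwards [hφ.tendsto_atTop.eventually_ge_atTop n] with m hm
    have h1 : (k : ℝ≥0) * (2 ^ n : ℝ≥0)⁻¹
        = ((k * 2 ^ (φ m - n) : ℕ) : ℝ≥0) * (2 ^ φ m : ℝ≥0)⁻¹ := by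
      obtain ⟨d, hd⟩ := Nat.exists_eq_add_of_le hm
      rw [hd, Nat.add_sub_cancel_left, pow_add]
      push_cast
      field_simp
    simp only [Function.comp_apply]
    rw [h1, T.predual_nat_mul (hf _)]
  have hapx : Filter.Tendsto (fun n : ℕ => (⌊(t : ℝ) * 2 ^ n⌋₊ : ℝ≥0) * (2 ^ n : ℝ≥0)⁻¹)
      Filter.atTop (nhds t) := by
    have h2 : Filter.Tendsto (fun n : ℕ => (2 ^ n : ℝ)) Filter.atTop Filter.atTop :=
      tendsto_pow_atTop_atTop_of_one_lt one_lt_two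
    rw [← NNReal.tendsto_coe]
    refine ((tendsto_nat_floor_mul_div_atTop t.2).comp h2).congr fun n => ?_
    simp [div_eq_mul_inv]
  refine tendsto_nhds_unique (((T.continuous_predual_apply ρ).tendsto t).comp hapx) ?_
  refine Filter.Tendsto.congr (fun n => (hdy _ n).symm) tendsto_const_nhds

theorem exists_isInvariantDensity [Nontrivial H] : ∃ ρ, T.IsInvariantDensity ρ := by
  obtain ⟨ρ, -, h⟩ := T.exists_invariant_mem subset_rfl isCompact_setOf_isDensity.isClosed
    convex_setOf_isDensity exists_isDensity fun t η hη => T.isDensity_predual hη t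
  exact ⟨ρ, h⟩

/-- If `tr (· x)` is preserved on densities with `tr (η x) = c`, some invariant density also has
that value. -/
theorem exists_isInvariantDensity_tr_eq {x : H →L[ℂ] H} {c : ℂ}
    (hx : ∀ η, IsDensity η → tr (η * x) = c → ∀ t, tr (η * T.map t x) = c)
    (hne : ∃ η, IsDensity η ∧ tr (η * x) = c) :
    ∃ ρ, T.IsInvariantDensity ρ ∧ tr (ρ * x) = c := by
  obtain ⟨ρ, hρ, h⟩ := T.exists_invariant_mem (K := {η | IsDensity η ∧ tr (η * x) = c})
    (fun η h => h.1)
    (isCompact_setOf_isDensity.isClosed.inter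
      (isClosed_eq (continuous_tr.comp (continuous_mul_const x)) continuous_const))
    (by
      intro a ha b hb s t hs ht hst
      refine ⟨convex_setOf_isDensity ha.1 hb.1 hs ht hst, ?_⟩
      have hst' : (s : ℂ) + t = 1 := by exact_mod_cast hst
      rw [add_mul, tr_add, smul_mul_assoc, smul_mul_assoc, tr_real_smul, tr_real_smul, ha.2, hb.2,
        ← add_mul, hst', one_mul])
    hne
    (fun t η hη => ⟨T.isDensity_predual hη.1 t, by
      rw [T.tr_predual]; exact hx η hη.1 hη.2 t⟩)
  exact ⟨ρ, h, hρ.2⟩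

/-- If all invariant densities are faithful, then there is exactly one. -/
theorem isPrimitive_of_forall_isFaithful [Nontrivial H]
    (h : ∀ ρ, T.IsInvariantDensity ρ → IsFaithful ρ) : T.IsPrimitive := by
  obtain ⟨ρ, hρ⟩ := T.exists_isInvariantDensity
  refine ⟨ρ, hρ, h ρ hρ, fun σ hσ => ?_⟩
  by_contra hne
  set δ := ρ - σ with hδ
  have hδ0 : 0 < ‖δ‖ := norm_pos_iff.2 (sub_ne_zero.2 (Ne.symm hne))
  have hδsa : IsSelfAdjoint δ :=
    (IsSelfAdjoint.of_nonneg hρ.1.1).sub (IsSelfAdjoint.of_nonneg hσ.1.1)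
  have htr : tr δ = 0 := by rw [hδ, tr_sub, hρ.1.2, hσ.1.2, sub_self]
  -- The line from `σ` through `ρ` is followed until it leaves the positive cone. The last point is
  -- an invariant density, hence strictly positive by hypothesis, so the line could have been
  -- followed further.
  let S : Set ℝ := {s | 0 ≤ ρ + s • δ}
  have hSd : ∀ s ∈ S, IsDensity (ρ + s • δ) := fun s hs =>
    ⟨hs, by rw [tr_add, tr_real_smul, htr, hρ.1.2]; simp⟩
  have hScl : IsClosed S :=
    isClosed_Ici.preimage (f := fun s : ℝ => ρ + s • δ) (by fun_prop)
  have hSb : BddAbove S := ⟨2 / ‖δ‖, fun s hs => by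
    rw [le_div_iff₀ hδ0]
    have h1 := norm_le_tr (hSd s hs).1
    have h2 := norm_le_tr hρ.1.1
    rw [(hSd s hs).2] at h1
    rw [hρ.1.2] at h2
    have h3 : ‖s • δ‖ ≤ ‖ρ + s • δ‖ + ‖ρ‖ := by
      simpa using norm_sub_le (ρ + s • δ) ρ
    rw [norm_smul, Real.norm_eq_abs] at h3
    have h4 := mul_le_mul_of_nonneg_right (le_abs_self s) hδ0.le
    simp only [Complex.one_re] at h1 h2
    linarith⟩
  have hmax : sSup S ∈ S := hScl.csSup_mem ⟨0, by simpa [S] using hρ.1.1⟩ hSb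
  set s := sSup S
  have hinv : T.IsInvariantDensity (ρ + s • δ) := ⟨hSd s hmax, fun t => by
    have : T.predual t (s • δ) = s • T.predual t δ := (T.predual t).map_smul_of_tower s δ
    rw [_root_.map_add, this, hδ, map_sub, hρ.2, hσ.2]⟩
  have hpos : IsStrictlyPositive (ρ + s • δ) := ⟨hmax, isUnit_of_isFaithful (h _ hinv)⟩
  obtain ⟨ε, hε, hle⟩ := exists_pos_algebraMap_le hpos
  -- Since `δ ≥ -‖δ‖`, a further step of length `ε / ‖δ‖` costs at most `ε`.
  have hs' : s + ε / ‖δ‖ ∈ S := by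
    have h1 := hδsa.neg_algebraMap_norm_le_self
    have h2 := smul_le_smul_of_nonneg_left h1 (div_pos hε hδ0).le
    have h3 := add_le_add hle h2
    have h4 : (ε / ‖δ‖) • -(algebraMap ℝ (H →L[ℂ] H)) ‖δ‖ = -(algebraMap ℝ (H →L[ℂ] H)) ε := by
      rw [smul_neg, Algebra.algebraMap_eq_smul_one, smul_smul, div_mul_cancel₀ _ hδ0.ne',
        Algebra.algebraMap_eq_smul_one]
    rw [h4, add_neg_cancel] at h3
    change 0 ≤ ρ + (s + ε / ‖δ‖) • δ
    rwa [add_smul, ← add_assoc]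
  have := le_csSup hSb hs'
  have := div_pos hε hδ0
  linarith

/-- The support projection of an invariant density is subharmonic, so the invariant densities of an
irreducible semigroup are faithful. -/
theorem IsIrreducible.isFaithful {T : QMS H} (hT : T.IsIrreducible) {ρ : H →L[ℂ] H}
    (hρ : T.IsInvariantDensity ρ) : IsFaithful ρ := by
  set p := (support ρ).starProjection
  have hps : IsStarProjection p := isStarProjection_starProjection
  have hpρ : p * ρ = ρ := by
    ext v
    refine Submodule.starProjection_eq_self_iff.2 ?_
    exact Submodule.le_topologicalClosure _ ⟨v, rfl⟩
  have hq : IsStarProjection (1 - p) := hps.one_sub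
  have h := hT p hps fun t => by
    -- Invariance gives `tr (b * ρ) = tr ((1 - p) * ρ) = 0`, so `b` kills the support of `ρ`. It
    -- thus lives on the complementary corner, where `b ≤ 1` reads `b ≤ 1 - p`.
    set b := T.map t (1 - p) with hb
    have hb0 : 0 ≤ b := map_nonneg _ hq.nonneg
    have hb1 : b ≤ 1 := by
      rw [← T.map_one t]
      exact OrderHomClass.mono (T.map t) (sub_le_self _ hps.nonneg)
    have h1 : tr (b * ρ) = 0 := by
      rw [tr_mul_comm, hb, ← T.tr_predual, hρ.2, tr_mul_comm, sub_mul, hpρ]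
      simp
    have h2 := mul_eq_zero_of_tr_mul_eq_zero hb0 hρ.1.1 h1
    have h3 : b * p = 0 := by
      ext v
      have h4 : support ρ ≤ LinearMap.ker (b : H →ₗ[ℂ] H) := by
        refine Submodule.topologicalClosure_minimal _ ?_ b.isClosed_ker
        rintro _ ⟨w, rfl⟩
        exact congrArg (fun c : H →L[ℂ] H => c w) h2
      exact h4 (Submodule.starProjection_apply_mem _ v)
    have h5 : (1 - p) * b * (1 - p) = b := by
      have h6 : p * b = 0 := by
        have := congrArg star h3
        rwa [star_mul, hps.isSelfAdjoint.star_eq, (IsSelfAdjoint.of_nonneg hb0).star_eq,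
          star_zero] at this
      rw [sub_mul, one_mul, h6, sub_zero, mul_sub, h3, mul_one, sub_zero]
    have h7 : b ≤ 1 - p := by
      have := star_left_conjugate_le_conjugate hb1 (1 - p)
      rwa [hq.isSelfAdjoint.star_eq, h5, mul_one, hq.isIdempotentElem.eq] at this
    have h8 : T.map t p = 1 - b := by
      rw [hb, map_sub, T.map_one]; simp
    rw [h8]
    exact le_sub_comm.1 h7
  rcases h with h | h
  · exfalso
    have := hρ.1.2
    rw [← hpρ, h] at this
    simp at this
  · rw [IsFaithful, eq_top_iff]
    intro v _
    have : p v = v := by rw [h]; rfl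
    exact Submodule.starProjection_eq_self_iff.1 this

/-- The fixed points of a primitive semigroup are the multiples of the identity. -/
theorem eq_tr_smul_one_of_fixed {ρ : H →L[ℂ] H} (huniq : ∀ ρ', T.IsInvariantDensity ρ' → ρ' = ρ)
    {x : H →L[ℂ] H} (hx : ∀ t, T.map t x = x) : x = tr (ρ * x) • (1 : H →L[ℂ] H) := by
  -- The densities with the same value of `tr (· * x)` as `η` form an invariant set, so they include
  -- an invariant density, necessarily `ρ`.
  have key : ∀ η, IsDensity η → tr (η * x) = tr (ρ * x) := fun η hη => by
    obtain ⟨σ, hσ, h⟩ := T.exists_isInvariantDensity_tr_eq (x := x) (c := tr (η * x))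
      (fun ζ _ h t => by rw [hx, h]) ⟨η, hη, rfl⟩
    rw [← h, huniq σ hσ]
  rw [← sub_eq_zero]
  suffices h : ∀ v : H, ⟪v, (x - tr (ρ * x) • (1 : H →L[ℂ] H)) v⟫_ℂ = 0 by
    refine ContinuousLinearMap.coe_injective ((inner_map_self_eq_zero _).1 fun v => ?_)
    rw [← inner_conj_symm]
    exact (congrArg _ (h v)).trans (_root_.map_zero _)
  intro v
  by_cases hv : v = 0
  · simp [hv]
  have hv' : ‖v‖ ≠ 0 := norm_ne_zero_iff.2 hv
  have hvc : (‖v‖ : ℂ) ≠ 0 := by exact_mod_cast hv'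
  have h := key _ (isDensity_rankOne_self (v := (‖v‖⁻¹ : ℂ) • v) (by
        rw [norm_smul, norm_inv, Complex.norm_real, norm_norm, inv_mul_cancel₀ hv']))
  rw [tr_rankOne_mul, map_smul, inner_smul_left, inner_smul_right] at h
  have h2 : ⟪v, x v⟫_ℂ = tr (ρ * x) * (‖v‖ : ℂ) ^ 2 := by
    rw [← h]
    simp
    field_simp
  simp only [sub_apply, smul_apply, one_apply_eq_self, inner_sub_right, inner_smul_right, h2,
    inner_self_eq_norm_sq_to_K]
  simp

end QMS

/-! ### The Schwarz inequality and its equality case. -/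

theorem CStarMatrix.apply_self_nonneg {n A : Type*} [Fintype n] [NonUnitalCStarAlgebra A]
    [PartialOrder A] [StarOrderedRing A] {M : CStarMatrix n n A} (hM : 0 ≤ M) (i : n) :
    0 ≤ M i i := by
  rw [StarOrderedRing.nonneg_iff] at hM
  induction hM using AddSubmonoid.closure_induction with
  | mem M h =>
    obtain ⟨B, rfl⟩ := h
    simp only [CStarMatrix.mul_apply]
    exact Finset.sum_nonneg fun k _ => star_mul_self_nonneg (B k i)
  | zero => exact le_rfl
  | add M N _ _ hM hN => exact add_nonneg hM hN

section Schwarz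

variable {A₁ A₂ : Type*} [CStarAlgebra A₁] [PartialOrder A₁] [StarOrderedRing A₁] [CStarAlgebra A₂]
  [PartialOrder A₂] [StarOrderedRing A₂]

/-- The entrywise image of `star B * B = !![1, x; star x, star x * x]` is positive, hence
self-adjoint; its off-diagonal entries are compared. -/
theorem CompletelyPositiveMap.map_star (Φ : A₁ →CP A₂) (x : A₁) : Φ (star x) = star (Φ x) := by
  let B : CStarMatrix (Fin 2) (Fin 2) A₁ := CStarMatrix.ofMatrix !![1, x; 0, 0]
  have hM := Φ.map_cstarMatrix_nonneg _ (star_mul_self_nonneg B)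
  have h := CStarMatrix.star_apply_of_isSelfAdjoint (IsSelfAdjoint.of_nonneg hM)
    (i := 0) (j := 1)
  simpa [CStarMatrix.mul_apply, Fin.sum_univ_two, CStarMatrix.star_apply, B] using h.symm

/-- The Kadison–Schwarz inequality for a unital completely positive map. -/
theorem CompletelyPositiveMap.star_mul_self_le (Φ : A₁ →CP A₂) (hΦ : Φ 1 = 1) (x : A₁) :
    star (Φ x) * Φ x ≤ Φ (star x * x) := by
  let B : CStarMatrix (Fin 2) (Fin 2) A₁ := CStarMatrix.ofMatrix !![1, x; 0, 0]
  -- Conjugation by the second column of `C` turns the image of `star B * B` into `Φ (star x * x) -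
  -- star (Φ x) * Φ x`.
  let C : CStarMatrix (Fin 2) (Fin 2) A₂ := CStarMatrix.ofMatrix !![0, -Φ x; 0, 1]
  have hM := Φ.map_cstarMatrix_nonneg _ (star_mul_self_nonneg B)
  have h := CStarMatrix.apply_self_nonneg (star_left_conjugate_nonneg hM C) 1
  simpa [CStarMatrix.mul_apply, Fin.sum_univ_two, CStarMatrix.star_apply, B, C, hΦ,
    Φ.map_star] using h

end Schwarz

namespace Quantum

variable {H : Type*} [NormedAddCommGroup H] [InnerProductSpace ℂ H] [CompleteSpace H]
  [FiniteDimensional ℂ H]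

/-- Equality in the Schwarz inequality implies multiplicativity. -/
theorem map_mul_of_star_mul_self_eq {Φ : (H →L[ℂ] H) →CP (H →L[ℂ] H)} (hΦ : Φ 1 = 1)
    {x : H →L[ℂ] H} (hx : Φ (star x * x) = star (Φ x) * Φ x) (y : H →L[ℂ] H) :
    Φ (y * x) = Φ y * Φ x := by
  set d : H →L[ℂ] H := Φ (y * x) - Φ y * Φ x with hd
  set e : H →L[ℂ] H := Φ (y * star y) - Φ y * star (Φ y) with he
  -- Schwarz for `c • x + star y`: the terms quadratic in `c` cancel by `hx`, leaving a real-affine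
  -- function of `c` that stays positive, so its linear part must vanish.
  have hpos : ∀ c : ℂ, 0 ≤ c • d + star (c • d) + e := fun c => by
    have h := sub_nonneg.2 (Φ.star_mul_self_le hΦ (c • x + star y))
    have h1 : Φ (star (c • x + star y) * (c • x + star y))
        - star (Φ (c • x + star y)) * Φ (c • x + star y) = c • d + star (c • d) + e := by
      have h2 : star (Φ (y * x)) = Φ (star x * star y) := by rw [← Φ.map_star, star_mul]
      simp only [hd, he, star_add, star_smul, star_star, add_mul, mul_add, map_add, map_smul,
        smul_mul_assoc, mul_smul_comm, Φ.map_star, hx, smul_sub, smul_add, star_sub, star_mul, h2]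
      abel
    rwa [h1] at h
  rw [← sub_eq_zero, ← hd]
  refine ContinuousLinearMap.coe_injective ((inner_map_self_eq_zero _).1 fun v => ?_)
  change ⟪d v, v⟫_ℂ = 0
  rw [← inner_conj_symm, map_eq_zero]
  by_contra hne
  set δ := ⟪v, d v⟫_ℂ with hδ
  have hn : 0 < Complex.normSq δ := Complex.normSq_pos.2 hne
  -- With `c = -r * star δ` the quadratic form at `v` has real part `-2 (E + 1) + E < 0`, where `E ≥
  -- 0` is that of `e`.
  set r : ℝ := ((⟪v, e v⟫_ℂ).re + 1) / Complex.normSq δ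
  have h := (Complex.nonneg_iff.1 (inner_nonneg_of_nonneg (hpos (-(r : ℂ) * star δ)) v)).1
  have h3 : ∀ a : H →L[ℂ] H, ⟪v, star a v⟫_ℂ = star ⟪v, a v⟫_ℂ := fun a => by
    rw [ContinuousLinearMap.star_eq_adjoint, ContinuousLinearMap.adjoint_inner_right]
    exact (inner_conj_symm _ _).symm
  have h4 : ⟪v, ((-(r : ℂ) * star δ) • d) v⟫_ℂ = ((-r * Complex.normSq δ : ℝ) : ℂ) := by
    rw [smul_apply, inner_smul_right, ← hδ, mul_assoc, mul_comm (star δ)]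
    have : δ * star δ = Complex.normSq δ := Complex.mul_conj δ
    rw [this]
    push_cast
    ring
  rw [add_apply, add_apply, inner_add_right, inner_add_right, h3, h4] at h
  have h5 : r * Complex.normSq δ = (⟪v, e v⟫_ℂ).re + 1 := div_mul_cancel₀ _ hn.ne'
  rw [neg_mul, h5] at h
  have h6 : 0 ≤ (⟪v, e v⟫_ℂ).re := by
    simpa using (Complex.nonneg_iff.1 (inner_nonneg_of_nonneg (hpos 0) v)).1
  simp at h
  linarith

end Quantum

/-! ### Eigenvectors for unimodular eigenvalues. -/

namespace QMS

open Quantum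

variable {H : Type*} [NormedAddCommGroup H] [InnerProductSpace ℂ H] [CompleteSpace H]
  [FiniteDimensional ℂ H] (T : QMS H)

theorem tr_mul_map {T : QMS H} {ρ : H →L[ℂ] H} (hρ : T.IsInvariantDensity ρ) (t : ℝ≥0)
    (x : H →L[ℂ] H) : tr (ρ * T.map t x) = tr (ρ * x) := by
  rw [← T.tr_predual, hρ.2]

/-- A subharmonic operator of a semigroup with a faithful invariant density is a fixed point. -/
theorem map_eq_of_le_map {T : QMS H} {ρ : H →L[ℂ] H} (hρ : T.IsInvariantDensity ρ)
    (hf : IsFaithful ρ) {t : ℝ≥0} {x : H →L[ℂ] H} (h : x ≤ T.map t x) : T.map t x = x := by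
  refine sub_eq_zero.1 (eq_zero_of_isFaithful hρ.1.1 hf (sub_nonneg.2 h) ?_)
  rw [mul_sub, tr_sub, tr_mul_map hρ, sub_self]

theorem star_mul_self_of_map_eq_smul {t : ℝ≥0} {x : H →L[ℂ] H} {z : ℂ} (hx : T.map t x = z • x) :
    star (T.map t x) * T.map t x = ((‖z‖ ^ 2 : ℝ) : ℂ) • (star x * x) := by
  rw [hx, star_smul, smul_mul_smul_comm]
  congr 1
  rw [Complex.star_def, Complex.conj_mul']
  norm_cast

/-- With a faithful invariant density, all eigenvalues lie in the closed unit disc. -/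
theorem norm_le_one_of_map_eq_smul {T : QMS H} {ρ : H →L[ℂ] H} (hρ : T.IsInvariantDensity ρ)
    (hf : IsFaithful ρ) {t : ℝ≥0} {x : H →L[ℂ] H} (hx0 : x ≠ 0) {z : ℂ}
    (hx : T.map t x = z • x) : ‖z‖ ≤ 1 := by
  have h1 := (T.map t).star_mul_self_le (T.map_one t) x
  rw [T.star_mul_self_of_map_eq_smul hx] at h1
  have h2 := tr_mul_nonneg hρ.1.1 (sub_nonneg.2 h1)
  have h3 := tr_mul_nonneg hρ.1.1 (star_mul_self_nonneg x)
  have h4 : tr (ρ * (star x * x)) ≠ 0 := fun h => hx0 <|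
    (CStarRing.star_mul_self_eq_zero_iff x).1
      (eq_zero_of_isFaithful hρ.1.1 hf (star_mul_self_nonneg x) h)
  rw [mul_sub, tr_sub, tr_mul_map hρ, mul_smul_comm, tr_smul] at h2
  obtain ⟨r, hr⟩ : ∃ r : ℝ, tr (ρ * (star x * x)) = r :=
    ⟨_, Complex.ext rfl (by simpa using (Complex.nonneg_iff.1 h3).2.symm)⟩
  rw [hr] at h2 h3 h4
  norm_cast at h2 h3 h4
  have hr0 : 0 < r := lt_of_le_of_ne (by exact_mod_cast h3) (Ne.symm h4)
  by_contra! hz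
  have : (1 : ℝ) < ‖z‖ ^ 2 := one_lt_pow₀ hz two_ne_zero
  nlinarith

/-- For a primitive semigroup, a common eigenvector for unimodular eigenvalues is a multiple of an
isometry on which the maps are multiplicative. -/
theorem peripheral_eigenvector {T : QMS H} {ρ : H →L[ℂ] H} (hρ : T.IsInvariantDensity ρ)
    (hf : IsFaithful ρ) (huniq : ∀ ρ', T.IsInvariantDensity ρ' → ρ' = ρ) {x : H →L[ℂ] H}
    (hx0 : x ≠ 0) {z : ℝ≥0 → ℂ} (hz : ∀ t, ‖z t‖ = 1) (hx : ∀ t, T.map t x = z t • x) :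
    IsUnit x ∧ ∀ (n : ℕ) t, T.map t (x ^ n) = z t ^ n • x ^ n := by
  have h1 : ∀ t, star (T.map t x) * T.map t x = star x * x := fun t => by
    rw [T.star_mul_self_of_map_eq_smul (hx t), hz t]
    simp
  -- By `h1` and Schwarz, `star x * x` is subharmonic, so the faithful `ρ` makes it a fixed point.
  have h2 : ∀ t, T.map t (star x * x) = star x * x := fun t =>
    map_eq_of_le_map hρ hf ((h1 t).symm.trans_le ((T.map t).star_mul_self_le (T.map_one t) x))
  constructor
  · have h3 := T.eq_tr_smul_one_of_fixed huniq h2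
    set c := tr (ρ * (star x * x))
    have hc : c ≠ 0 := fun hc => hx0 <| (CStarRing.star_mul_self_eq_zero_iff x).1 (by
      rw [h3, hc, zero_smul])
    have h4 : Function.Injective (x : H →ₗ[ℂ] H) := by
      rw [← LinearMap.ker_eq_bot, LinearMap.ker_eq_bot']
      intro v hv
      have h5 : (star x * x) v = 0 := by
        have : x v = 0 := hv
        simp [this]
      rw [h3] at h5
      simpa [hc] using h5
    rw [ContinuousLinearMap.isUnit_iff_bijective]
    exact ⟨h4, LinearMap.injective_iff_surjective.1 h4⟩
  · intro n t
    induction n with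
    | zero => simp [T.map_one]
    | succ n ih =>
      rw [pow_succ, map_mul_of_star_mul_self_eq (T.map_one t) (by rw [h1, h2]), ih, hx,
        smul_mul_smul_comm, pow_succ]

end QMS

/-- By Gelfand's formula `‖a ^ n‖` is eventually at most `c ^ n`, for any `c < 1` above the spectral
radius. -/
theorem tendsto_pow_zero_of_spectrum_lt {A : Type*} [NormedRing A] [NormedAlgebra ℂ A]
    [CompleteSpace A] [Nontrivial A] {a : A} (h : ∀ z ∈ spectrum ℂ a, ‖z‖ < 1) :
    Filter.Tendsto (fun n : ℕ => a ^ n) Filter.atTop (nhds 0) := by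
  have h1 : spectralRadius ℂ a < (1 : ℝ≥0) :=
    spectrum.spectralRadius_lt_of_forall_lt_of_nonempty (spectrum.nonempty a) fun z hz => by
      exact_mod_cast h z hz
  obtain ⟨c, hc, hc1⟩ := ENNReal.lt_iff_exists_nnreal_btwn.1 h1
  have h2 := (spectrum.pow_nnnorm_pow_one_div_tendsto_nhds_spectralRadius a).eventually_lt_const hc
  have hc1' : (c : ℝ) < 1 := by exact_mod_cast hc1
  refine squeeze_zero_norm' ?_ (tendsto_pow_atTop_nhds_zero_of_lt_one c.2 hc1')
  filter_upwards [h2, Filter.eventually_gt_atTop 0] with n hn hn0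
  have hn0' : (0 : ℝ) < n := by exact_mod_cast hn0
  have h3 := ENNReal.rpow_le_rpow hn.le hn0'.le
  rw [← ENNReal.rpow_mul, one_div_mul_cancel hn0'.ne', ENNReal.rpow_one,
    ENNReal.rpow_natCast] at h3
  exact_mod_cast h3

/-! ### The generator, its imaginary spectrum and convergence. -/

namespace QMS

open Quantum

variable {H : Type*} [NormedAddCommGroup H] [InnerProductSpace ℂ H] [CompleteSpace H]
  [FiniteDimensional ℂ H] (T : QMS H)

theorem hasDerivWithinAt_map (x : H →L[ℂ] H) {t : ℝ} (ht : 0 ≤ t) :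
    HasDerivWithinAt (fun s : ℝ => T.map s.toNNReal x) (T.generator (T.map t.toNNReal x))
      (Set.Ici t) t := by
  have h0 : HasDerivWithinAt (fun s : ℝ => T.map s.toNNReal (T.map t.toNNReal x))
      (T.generator (T.map t.toNNReal x)) (Set.Ici 0) (t - t) := by
    rw [sub_self]
    exact T.hasDerivWithinAt_generator _
  have h1 := h0.scomp (h := fun s : ℝ => s - t) t
    ((hasDerivAt_id t).sub_const t).hasDerivWithinAt (fun s (hs : t ≤ s) => sub_nonneg.2 hs : Set.MapsTo _ (Set.Ici t) _)
  rw [one_smul] at h1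
  refine h1.congr (fun s (hs : t ≤ s) => ?_) ?_
  · simp only [Function.comp_apply]
    rw [← T.map_add, ← Real.toNNReal_add (sub_nonneg.2 hs) ht, sub_add_cancel]
  · simp [T.map_zero]

/-- The orbits of the semigroup are the solutions of the differential equation `v' = 𝓛 v`. -/
theorem map_eq_of_hasDerivAt {v : ℝ → H →L[ℂ] H}
    (hv : ∀ t, HasDerivAt v (T.generator (v t)) t) (t : ℝ≥0) : T.map t (v 0) = v t := by
  let L := LinearMap.toContinuousLinearMap T.generator
  have h := ODE_solution_unique (v := fun _ => L) (K := ‖L‖₊) (a := 0) (b := t)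
    (f := fun s : ℝ => T.map s.toNNReal (v 0)) (g := v) (fun _ => L.lipschitz)
    ((T.continuous_map_apply _).comp continuous_real_toNNReal).continuousOn
    (fun s hs => T.hasDerivWithinAt_map _ hs.1)
    (fun s _ => (hv s).continuousAt.continuousWithinAt)
    (fun s _ => (hv s).hasDerivWithinAt) (by simp [T.map_zero]) ⟨t.2, le_rfl⟩
  simpa using h

theorem map_eq_exp (t : ℝ≥0) (x : H →L[ℂ] H) : T.map t x =
    NormedSpace.exp ((t : ℝ) • LinearMap.toContinuousLinearMap T.generator) x := by
  set L := LinearMap.toContinuousLinearMap T.generator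
  have h := T.map_eq_of_hasDerivAt (v := fun s : ℝ => NormedSpace.exp (s • L) x) (fun s =>
    ((ContinuousLinearMap.apply ℂ (H →L[ℂ] H) x).restrictScalars
      ℝ).hasFDerivAt.comp_hasDerivAt s (hasDerivAt_exp_smul_const' L s)) t
  have h0 : NormedSpace.exp ((0 : ℝ) • L) x = x := by
    have hz : (0 : ℝ) • L = 0 := zero_smul ℝ L
    rw [hz, NormedSpace.exp_zero]
    rfl
  rwa [h0] at h

theorem map_of_generator_eq_smul {x : H →L[ℂ] H} {μ : ℂ} (hx : T.generator x = μ • x) (t : ℝ≥0) :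
    T.map t x = Complex.exp (μ * (t : ℝ)) • x := by
  have h := T.map_eq_of_hasDerivAt (v := fun s : ℝ => Complex.exp (μ * s) • x) (fun s => by
    have h1 : HasDerivAt (fun s : ℝ => Complex.exp (μ * s)) (Complex.exp (μ * s) * μ) s := by
      have := ((hasDerivAt_id (s : ℂ)).const_mul μ).cexp.comp_ofReal
      simpa using this
    have h2 := h1.smul_const x
    rwa [map_smul, hx, smul_smul]) t
  simpa using h

theorem generator_eq_of_hasDerivWithinAt {x y : H →L[ℂ] H}
    (h : HasDerivWithinAt (fun t : ℝ => T.map t.toNNReal x) y (Set.Ici 0) 0) :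
    T.generator x = y :=
  (uniqueDiffOn_Ici 0 0 Set.self_mem_Ici).eq_deriv _ (T.hasDerivWithinAt_generator x) h

theorem generator_eq_smul_of_map {x : H →L[ℂ] H} {μ : ℂ}
    (hx : ∀ t : ℝ≥0, T.map t x = Complex.exp (μ * (t : ℝ)) • x) : T.generator x = μ • x := by
  refine T.generator_eq_of_hasDerivWithinAt ?_
  have h1 : HasDerivAt (fun s : ℝ => Complex.exp (μ * s)) μ 0 := by
    have := ((hasDerivAt_id ((0 : ℝ) : ℂ)).const_mul μ).cexp.comp_ofReal
    simpa using this
  refine (h1.smul_const x).hasDerivWithinAt.congr (fun t ht => ?_) ?_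
  · simp [hx, Real.coe_toNNReal t ht]
  · simp [T.map_zero]

theorem generator_map (t : ℝ≥0) (x : H →L[ℂ] H) :
    T.generator (T.map t x) = T.map t (T.generator x) := by
  refine T.generator_eq_of_hasDerivWithinAt ?_
  have h := ((LinearMap.toContinuousLinearMap (T.map t).toLinearMap).restrictScalars
    ℝ).hasFDerivAt.comp_hasDerivWithinAt 0 (T.hasDerivWithinAt_generator x)
  refine h.congr (fun s _ => ?_) ?_
  · rw [← T.map_add, add_comm, T.map_add]
    rfl
  · rw [← T.map_add, add_comm, T.map_add]
    rfl

theorem generator_one : T.generator 1 = 0 := by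
  simpa using T.generator_eq_smul_of_map (x := 1) (μ := 0) (by simp [T.map_one])

theorem tr_mul_generator {T : QMS H} {ρ : H →L[ℂ] H} (hρ : T.IsInvariantDensity ρ)
    (x : H →L[ℂ] H) : tr (ρ * T.generator x) = 0 := by
  have h := ((LinearMap.toContinuousLinearMap (traceForm H ρ)).restrictScalars
    ℝ).hasFDerivAt.comp_hasDerivWithinAt 0 (T.hasDerivWithinAt_generator x)
  refine (uniqueDiffOn_Ici (0 : ℝ) 0 Set.self_mem_Ici).eq_deriv _ h ?_
  exact (hasDerivWithinAt_const 0 (Set.Ici 0) (tr (ρ * x))).congr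
    (fun s _ => tr_mul_map hρ _ x) (tr_mul_map hρ _ x)

section Primitive

variable {T} {ρ : H →L[ℂ] H} (hρ : T.IsInvariantDensity ρ) (hf : IsFaithful ρ)
  (huniq : ∀ ρ', T.IsInvariantDensity ρ' → ρ' = ρ)

include hρ hf huniq

/-- The generator of a primitive semigroup has no non-zero imaginary eigenvalue: the powers of an
eigenvector would be eigenvectors for infinitely many eigenvalues. -/
theorem eq_zero_of_generator_eq_smul {x : H →L[ℂ] H} (hx0 : x ≠ 0) {μ : ℂ} (hμ : μ.re = 0)
    (hx : T.generator x = μ • x) : μ = 0 := by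
  have : Nontrivial H := by
    by_contra hH
    rw [not_nontrivial_iff_subsingleton] at hH
    exact hx0 (ContinuousLinearMap.ext fun v => Subsingleton.elim _ _)
  obtain ⟨hu, hpow⟩ := peripheral_eigenvector hρ hf huniq hx0
    (z := fun t => Complex.exp (μ * (t : ℝ)))
    (fun t => by rw [Complex.norm_exp]; simp [hμ]) (T.map_of_generator_eq_smul hx)
  have hev : ∀ n : ℕ, Module.End.HasEigenvalue T.generator (n * μ) := fun n => by
    refine Module.End.hasEigenvalue_of_hasEigenvector (x := x ^ n)
      (Module.End.hasEigenvector_iff.2 ⟨Module.End.mem_eigenspace_iff.2 ?_, (hu.pow n).ne_zero⟩)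
    refine T.generator_eq_smul_of_map fun t => ?_
    rw [hpow, ← Complex.exp_nat_mul, mul_assoc]
  by_contra hne
  refine (Set.infinite_range_of_injective (f := fun n : ℕ => (n : ℂ) * μ) fun m n h => ?_)
    ((Module.End.finite_hasEigenvalue T.generator).subset (Set.range_subset_iff.2 hev))
  exact_mod_cast mul_right_cancel₀ hne h

/-- Several `μ` may share the value `exp μ = z`, so `x` itself need not be an eigenvector of the
generator. But the generator preserves the eigenspace of `z` inside the kernel of `tr (ρ * ·)`. If
`‖z‖ = 1`, its eigenvalues there are imaginary, hence zero; an eigenvector is then fixed and so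
scalar, yet has `ρ`-trace zero. -/
theorem norm_lt_one_of_map_one_eq_smul {x : H →L[ℂ] H} (hx0 : x ≠ 0) (hρx : tr (ρ * x) = 0)
    {z : ℂ} (hx : T.map 1 x = z • x) : ‖z‖ < 1 := by
  refine lt_of_le_of_ne (norm_le_one_of_map_eq_smul hρ hf hx0 hx) fun hz => ?_
  let E : Submodule ℂ (H →L[ℂ] H) :=
    Module.End.eigenspace (T.map 1).toLinearMap z ⊓ LinearMap.ker (traceForm H ρ)
  have hxE : x ∈ E := ⟨Module.End.mem_eigenspace_iff.2 hx, hρx⟩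
  have hE : ∀ y ∈ E, T.generator y ∈ E := fun y hy => by
    refine ⟨Module.End.mem_eigenspace_iff.2 ?_, tr_mul_generator hρ y⟩
    have h1 : T.map 1 y = z • y := Module.End.mem_eigenspace_iff.1 hy.1
    change T.map 1 (T.generator y) = _
    rw [← T.generator_map, h1, map_smul]
  have : Nontrivial E := ⟨⟨⟨x, hxE⟩, 0, fun h => hx0 (congrArg Subtype.val h)⟩⟩
  obtain ⟨μ, hμ⟩ := Module.End.exists_eigenvalue (T.generator.restrict hE)
  obtain ⟨⟨y, hyE⟩, hy⟩ := hμ.exists_hasEigenvector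
  have hy0 : y ≠ 0 := fun h => hy.2 (Subtype.ext h)
  have hyL : T.generator y = μ • y := congrArg Subtype.val hy.apply_eq_smul
  have hy1 : T.map 1 y = z • y := Module.End.mem_eigenspace_iff.1 hyE.1
  have hexp : Complex.exp μ = z := by
    have := T.map_of_generator_eq_smul hyL 1
    rw [hy1] at this
    simpa using (smul_left_injective ℂ hy0 this).symm
  have hre : μ.re = 0 := by
    rw [← hexp, Complex.norm_exp] at hz
    simpa using hz
  have hμ0 := eq_zero_of_generator_eq_smul hρ hf huniq hy0 hre hyL
  have hfix := T.eq_tr_smul_one_of_fixed huniq (x := y) fun t => by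
    rw [T.map_of_generator_eq_smul hyL, hμ0]
    simp
  have hty : tr (ρ * y) = 0 := hyE.2
  rw [hty, zero_smul] at hfix
  exact hy0 hfix

/-- A primitive semigroup converges to `x ↦ tr (ρ x) 1`. -/
theorem tendsto_map (x : H →L[ℂ] H) :
    Filter.Tendsto (fun t => T.map t x) Filter.atTop (nhds (tr (ρ * x) • 1)) := by
  rcases subsingleton_or_nontrivial H with hH | hH
  · have : Subsingleton (H →L[ℂ] H) :=
      ⟨fun a b => ContinuousLinearMap.ext fun v => Subsingleton.elim _ _⟩
    exact tendsto_const_nhds.congr fun t => Subsingleton.elim (tr (ρ * x) • 1) _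
  -- `R` is `T.map 1` minus its limit projection. Its powers subtract that same projection from
  -- `T.map n`, but only for `n ≥ 1`, whence the shifted exponents below.
  let R : (H →L[ℂ] H) →L[ℂ] (H →L[ℂ] H) := LinearMap.toContinuousLinearMap
    ((T.map 1).toLinearMap - (traceForm H ρ).smulRight 1)
  have hR : ∀ y, R y = T.map 1 y - tr (ρ * y) • (1 : H →L[ℂ] H) := fun y => rfl
  have hρ1 : tr (ρ * 1) = 1 := by rw [mul_one, hρ.1.2]
  have hRn : ∀ (n : ℕ) y, (R ^ (n + 1)) y = T.map (n + 1) y - tr (ρ * y) • (1 : H →L[ℂ] H) := by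
    intro n
    induction n with
    | zero => intro y; simp [hR]
    | succ n ih =>
      intro y
      rw [pow_succ, mul_apply_eq_comp, ih, hR, map_sub, map_smul, T.map_one,
        ← T.map_add, mul_sub, tr_sub, mul_smul_comm, tr_smul, hρ1, tr_mul_map hρ]
      simp
  have hspec : ∀ z ∈ spectrum ℂ R, ‖z‖ < 1 := fun z hz => by
    rw [ContinuousLinearMap.spectrum_eq, ← Module.End.hasEigenvalue_iff_mem_spectrum] at hz
    obtain ⟨y, hy⟩ := hz.exists_hasEigenvector
    have h1 : T.map 1 y - tr (ρ * y) • (1 : H →L[ℂ] H) = z • y := hy.apply_eq_smul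
    rcases eq_or_ne z 0 with hz0 | hz0
    · simp [hz0]
    have h2 : tr (ρ * y) = 0 := by
      have h3 := congrArg (fun a => tr (ρ * a)) h1
      simp only [mul_sub, tr_sub, mul_smul_comm, tr_smul, mul_one, hρ.1.2, tr_mul_map hρ,
        sub_self] at h3
      exact (mul_eq_zero.1 h3.symm).resolve_left hz0
    rw [h2, zero_smul, sub_zero] at h1
    exact norm_lt_one_of_map_one_eq_smul hρ hf huniq hy.2 h2 h1
  have hpow := (Filter.tendsto_add_atTop_iff_nat 1).2 (tendsto_pow_zero_of_spectrum_lt hspec)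
  obtain ⟨C, hC⟩ := (isCompact_Icc (a := (0 : ℝ≥0)) (b := 2)).exists_bound_of_continuousOn
    (T.continuous_map_apply x).continuousOn
  -- A real time is split as `(n + 1) + s` with `n + 1 = ⌊t⌋₊`; the orbit over the bounded range of
  -- `s` is bounded by `C`.
  have hfl : Filter.Tendsto (fun t : ℝ≥0 => ⌊t⌋₊ - 1) Filter.atTop Filter.atTop :=
    (Filter.tendsto_sub_atTop_nat 1).comp tendsto_nat_floor_atTop
  rw [tendsto_iff_norm_sub_tendsto_zero]
  refine squeeze_zero' (Filter.Eventually.of_forall fun _ => norm_nonneg _) ?_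
    (by simpa using ((tendsto_zero_iff_norm_tendsto_zero.1 hpow).comp hfl).mul_const C)
  filter_upwards [Filter.eventually_ge_atTop 1] with t ht
  have hn : 1 ≤ ⌊t⌋₊ := Nat.one_le_floor_iff _ |>.2 ht
  obtain ⟨n, hn'⟩ := Nat.exists_eq_add_of_le' hn
  have hle : (n + 1 : ℝ≥0) ≤ t := by
    have := Nat.floor_le (zero_le (a := t))
    rw [hn'] at this
    exact_mod_cast this
  have hlt : t < n + 1 + 1 := by
    have := Nat.lt_floor_add_one t
    rw [hn'] at this
    exact_mod_cast this
  obtain ⟨s, rfl⟩ := exists_add_of_le hle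
  have hs : s ≤ 2 := ((lt_of_add_lt_add_left hlt).trans one_lt_two).le
  have key : T.map (n + 1 + s) x - tr (ρ * x) • (1 : H →L[ℂ] H) = (R ^ (n + 1)) (T.map s x) := by
    rw [hRn, ← T.map_add, tr_mul_map hρ]
  rw [key]
  simp only [hn', Nat.add_sub_cancel]
  exact ((R ^ (n + 1)).le_opNorm _).trans
    (mul_le_mul_of_nonneg_left (hC s ⟨zero_le, hs⟩) (norm_nonneg _))

theorem relaxesTo {η : H →L[ℂ] H} (hη : IsDensity η) : T.RelaxesTo η ρ := by
  rw [RelaxesTo, tendsto_traceNorm_zero_iff, tendsto_sub_nhds_zero_iff]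
  refine tendsto_of_tendsto_tr fun x => ?_
  simp_rw [T.tr_predual]
  have h := (continuous_tr.comp (continuous_const_mul η)).tendsto _ |>.comp
    (tendsto_map hρ hf huniq x)
  simpa [Function.comp_def, hη.2] using h

end Primitive

end QMS

/-! ### Analyticity and positivity improvement. -/

namespace Quantum

variable {H : Type*} [NormedAddCommGroup H] [InnerProductSpace ℂ H] [CompleteSpace H]
  [FiniteDimensional ℂ H]

theorem analyticAt_det {g : ℝ → H →L[ℂ] H} {s : ℝ} (hg : AnalyticAt ℝ g s) :
    AnalyticAt ℝ (fun t => LinearMap.det (g t : H →ₗ[ℂ] H)) s := by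
  let b := (stdOrthonormalBasis ℂ H).toBasis
  let e : Fin (Module.finrank ℂ H) → Fin (Module.finrank ℂ H) → (H →L[ℂ] H) →ₗ[ℂ] ℂ := fun i j =>
    { toFun := fun a => LinearMap.toMatrix b b (a : H →ₗ[ℂ] H) i j
      map_add' := fun a c => by simp
      map_smul' := fun c a => by simp }
  have he : ∀ i j, AnalyticAt ℝ (fun t => e i j (g t)) s := fun i j =>
    (((LinearMap.toContinuousLinearMap (e i j)).restrictScalars ℝ).analyticAt (g s)).comp hg
  have h : (fun t => LinearMap.det (g t : H →ₗ[ℂ] H))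
      = fun t => ∑ σ : Equiv.Perm (Fin (Module.finrank ℂ H)),
        ((Equiv.Perm.sign σ : ℤ) : ℂ) * ∏ i, e (σ i) i (g t) := by
    funext t
    rw [← LinearMap.det_toMatrix b, Matrix.det_apply']
    rfl
  rw [h]
  exact Finset.analyticAt_fun_sum _ fun σ _ =>
    analyticAt_const.mul (Finset.analyticAt_fun_prod _ fun i _ => he _ _)

theorem isUnit_iff_det_ne_zero {a : H →L[ℂ] H} :
    IsUnit a ↔ LinearMap.det (a : H →ₗ[ℂ] H) ≠ 0 := by
  rw [ContinuousLinearMap.isUnit_iff_isUnit_toLinearMap, LinearMap.isUnit_iff_isUnit_det,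
    isUnit_iff_ne_zero]

end Quantum

namespace QMS

open Quantum

variable {H : Type*} [NormedAddCommGroup H] [InnerProductSpace ℂ H] [CompleteSpace H]
  [FiniteDimensional ℂ H] [Nontrivial H] {T : QMS H}

/-- A unital positive map preserves a lower bound `ε • 1`. Hence invertibility persists in time and
singularity propagates backwards. -/
theorem isStrictlyPositive_map {x : H →L[ℂ] H} (hx : IsStrictlyPositive x) (t : ℝ≥0) :
    IsStrictlyPositive (T.map t x) := by
  obtain ⟨ε, hε, hle⟩ := exists_pos_algebraMap_le hx
  have h1 : T.map t (algebraMap ℝ (H →L[ℂ] H) ε) = algebraMap ℝ (H →L[ℂ] H) ε := by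
    have h2 : algebraMap ℝ (H →L[ℂ] H) ε = (ε : ℂ) • (1 : H →L[ℂ] H) := rfl
    rw [h2, map_smul, T.map_one]
  have h3 : IsStrictlyPositive (algebraMap ℝ (H →L[ℂ] H) ε) :=
    ⟨algebraMap_nonneg _ hε.le, (isUnit_iff_ne_zero.2 hε.ne').map _⟩
  exact h3.of_le (h1 ▸ OrderHomClass.mono (T.map t) hle)

/-- A primitive semigroup is positivity improving. If `𝓣_t x` is singular, then so is `𝓣_s x` for
`s ≤ t`, hence for all `s` by analyticity of the determinant, against `𝓣_s x → tr (ρ x) 1`. -/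
theorem IsPrimitive.isPositivityImproving (hT : T.IsPrimitive) : T.IsPositivityImproving := by
  obtain ⟨ρ, hρ, hf, huniq⟩ := hT
  intro x hx hx0 t ht
  refine ⟨map_nonneg _ hx, ?_⟩
  by_contra hsing
  have hsing' : ∀ s ≤ t, ¬ IsUnit (T.map s x) := fun s hs hu => hsing <| by
    obtain ⟨r, rfl⟩ := exists_add_of_le hs
    rw [add_comm, T.map_add]
    exact (isStrictlyPositive_map ⟨map_nonneg _ hx, hu⟩ r).isUnit
  let L := LinearMap.toContinuousLinearMap T.generator
  let g : ℝ → H →L[ℂ] H := fun s => NormedSpace.exp (s • L) x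
  have hg : ∀ s : ℝ≥0, g s = T.map s x := fun s => (T.map_eq_exp s x).symm
  have han : AnalyticOnNhd ℝ (fun s => LinearMap.det (g s : H →ₗ[ℂ] H)) Set.univ := fun s _ => by
    refine analyticAt_det ?_
    have h1 : AnalyticAt ℝ (fun s : ℝ => NormedSpace.exp (s • L)) s :=
      (NormedSpace.exp_analytic (𝕂 := ℝ) (s • L)).comp (f := fun r : ℝ => r • L)
        (analyticAt_id.smul analyticAt_const)
    exact (((ContinuousLinearMap.apply ℂ (H →L[ℂ] H) x).restrictScalars ℝ).analyticAt _).comp h1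
  have ht' : (0 : ℝ) < t := ht
  -- The orbit agrees with `g` only at nonnegative times and is known singular only up to `t`, so an
  -- interior point of `(0, t)` is taken.
  have hev : (fun s => LinearMap.det (g s : H →ₗ[ℂ] H)) =ᶠ[nhds ((t : ℝ) / 2)] fun _ => 0 := by
    filter_upwards [Ioo_mem_nhds (half_pos ht') (half_lt_self ht')] with s hs
    lift s to ℝ≥0 using hs.1.le
    have h1 := hsing' s (by exact_mod_cast hs.2.le)
    rw [← hg, isUnit_iff_det_ne_zero, not_not] at h1
    exact h1
  have hzero := han.eqOn_of_preconnected_of_eventuallyEq (fun _ _ => analyticAt_const)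
    isPreconnected_univ (Set.mem_univ _) hev
  have hc : tr (ρ * x) ≠ 0 := fun h => hx0 (eq_zero_of_isFaithful hρ.1.1 hf hx h)
  have hlim : IsUnit (tr (ρ * x) • (1 : H →L[ℂ] H)) :=
    isUnit_one.smul (Units.mk0 _ hc)
  obtain ⟨s, hs⟩ := ((tendsto_map hρ hf huniq x).eventually (Units.isOpen.mem_nhds hlim)).exists
  have hs' : IsUnit (T.map s x) := hs
  rw [← hg, isUnit_iff_det_ne_zero] at hs'
  exact hs' (hzero (Set.mem_univ _))

/-- If `p` is subharmonic, `1 - p` dominates its own image. When `1 - p ≠ 0` that image is strictly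
positive, so `1 - p` is invertible and `p * (1 - p) = 0` gives `p = 0`. -/
theorem IsPositivityImproving.isIrreducibleMap (hT : T.IsPositivityImproving) {t : ℝ≥0}
    (ht : 0 < t) : IsIrreducibleMap (T.map t) := by
  intro p hp hsub
  by_cases hp1 : p = 1
  · exact Or.inr hp1
  left
  have hq := hp.one_sub
  have h1 := hT (1 - p) hq.nonneg (sub_ne_zero.2 (Ne.symm hp1)) t ht
  have h2 : T.map t (1 - p) ≤ 1 - p := by
    rw [map_sub, T.map_one]
    exact sub_le_sub_left hsub 1
  have h3 : p * (1 - p) = 0 := by rw [mul_sub, mul_one, hp.isIdempotentElem.eq, sub_self]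
  exact (h1.of_le h2).isUnit.mul_left_eq_zero.1 h3

theorem IsPrimitive.spectrum_inter (hT : T.IsPrimitive) :
    spectrum ℂ T.generator ∩ {z : ℂ | z.re = 0} = {0} := by
  obtain ⟨ρ, hρ, hf, huniq⟩ := hT
  ext z
  rw [Set.mem_inter_iff, ← Module.End.hasEigenvalue_iff_mem_spectrum, Set.mem_singleton_iff]
  constructor
  · rintro ⟨hz, hre⟩
    obtain ⟨x, hx⟩ := hz.exists_hasEigenvector
    exact eq_zero_of_generator_eq_smul hρ hf huniq hx.2 hre hx.apply_eq_smul
  · rintro rfl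
    refine ⟨Module.End.hasEigenvalue_of_hasEigenvector (x := 1)
      (Module.End.hasEigenvector_iff.2 ⟨Module.End.mem_eigenspace_iff.2 ?_, one_ne_zero⟩), rfl⟩
    rw [T.generator_one, zero_smul]

theorem RelaxesTo.unique {η ρ σ : H →L[ℂ] H} (h : T.RelaxesTo η ρ) (h' : T.RelaxesTo η σ) :
    ρ = σ := by
  rw [RelaxesTo, tendsto_traceNorm_zero_iff, tendsto_sub_nhds_zero_iff] at h h'
  exact tendsto_nhds_unique h h'

theorem IsInvariantDensity.relaxesTo {ρ : H →L[ℂ] H} (h : T.IsInvariantDensity ρ) :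
    T.RelaxesTo ρ ρ := by
  rw [RelaxesTo, tendsto_traceNorm_zero_iff]
  simp [h.2]

end QMS

end

/-! ### The equivalences. -/

theorem theorem4p2 {H : Type*} [NormedAddCommGroup H] [InnerProductSpace ℂ H] [CompleteSpace H]
    [FiniteDimensional ℂ H] [Nontrivial H] (T : QMS H) :
    List.TFAE [
      T.IsIrreducible,
      T.IsPrimitive,
      ∀ t₀ : ℝ≥0, 0 < t₀ → Quantum.IsIrreducibleMap (T.map t₀),
      ∃ t₀ : ℝ≥0, 0 < t₀ ∧ Quantum.IsIrreducibleMap (T.map t₀),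
      T.IsPrimitive ∧ spectrum ℂ T.generator ∩ {z : ℂ | z.re = 0} = {0},
      -- ergodic, with faithful limits
      T.IsErgodic ∧ ∀ η ρ, Quantum.IsDensity η → Quantum.IsDensity ρ → T.RelaxesTo η ρ →
        Quantum.IsFaithful ρ,
      -- ergodic, with one faithful limit for all initial densities
      ∃ ρ, Quantum.IsDensity ρ ∧ Quantum.IsFaithful ρ ∧
        ∀ η, Quantum.IsDensity η → T.RelaxesTo η ρ,
      T.IsPositivityImproving] := by
  tfae_have 1 → 2 := fun h => T.isPrimitive_of_forall_isFaithful fun ρ hρ => h.isFaithful hρ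
  tfae_have 2 → 5 := fun h => ⟨h, h.spectrum_inter⟩
  tfae_have 5 → 2 := fun h => h.1
  tfae_have 2 → 7 := fun ⟨ρ, hρ, hf, huniq⟩ =>
    ⟨ρ, hρ.1, hf, fun η hη => QMS.relaxesTo hρ hf huniq hη⟩
  tfae_have 7 → 6 := fun ⟨ρ, hρ, hf, h⟩ =>
    ⟨fun η hη => ⟨ρ, hρ, h η hη⟩, fun η σ hη _ hσ => (h η hη).unique hσ ▸ hf⟩
  tfae_have 6 → 2 := fun h => T.isPrimitive_of_forall_isFaithful fun ρ hρ =>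
    h.2 ρ ρ hρ.1 hρ.1 hρ.relaxesTo
  tfae_have 2 → 8 := fun h => h.isPositivityImproving
  tfae_have 8 → 3 := fun h t₀ ht₀ => h.isIrreducibleMap ht₀
  tfae_have 3 → 4 := fun h => ⟨1, one_pos, h 1 one_pos⟩
  tfae_have 4 → 1 := fun ⟨t₀, _, h⟩ p hp hsub => h p hp (hsub t₀)
  tfae_finish
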